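/- Morphisms are composed from left to right. A *category with subobjects* is a small category $\mathcal C$ with a subcategory $\mathcal P$ on the same objects, whose morphisms are called *inclusions*, such that $\mathcal P$ is a strict preorder (at most one inclusion $j(a,b)\colon a\to b$ for any two objects, and the only isomorphisms of $\mathcal P$ are identities), every inclusion is a monomorphism of $\mathcal C$, and if $hg$ and $g$ are inclusions then so is $h$. Write $a\preceq b$ if there is an inclusion $a\to b$. A *retraction* is a morphism $q\colon b\to a$ with $j(a,b)q=1_a$ for some inclusion $j(a,b)$. A *cone* with vertex $z$ is a family $\gamma(c)\colon c\to z$, indexed by all objects $c$, with $j(a,b)\gamma(b)=\gamma(a)$ whenever $a\preceq b$ and with $\gamma(c)$ an isomorphism for at least one $c$. The category $\mathcal C$ is *normal* if every inclusion has a right inverse, every morphism $f$ can be written $f=quj$ with $q$ a retraction, $u$ an isomorphism and $j$ an inclusion, and for every object $c$ there is a cone $\mu$ with vertex $c$ and $\mu(c)=1_c$. In a normal category the morphism $f^\circ=qu$ depends on $f$ only, and the set $\widehat{\mathcal C}$ of all cones is a regular semigroup under the product whose components are $(\gamma\cdot\delta)(c)=\gamma(c)\,(\delta(z_\gamma))^\circ$,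 where $z_\gamma$ is the vertex of $\gamma$. A normal category is *bounded above* if it has an object $k$ with $c\preceq k$ for all objects $c$. For a regular semigroup $S$, the set $S/\mathscr R$ of $\mathscr R$-classes is partially ordered by $R_a\sqsubseteq R_b$ iff $a\in bS$. In a normal category, an object $c$ is *connected by* $\mathfrak d\in\widehat{\mathcal C}/\mathscr R$ if $\mathfrak d$ contains an idempotent cone with vertex $c$; this cone is then unique and is denoted $\epsilon(c,\mathfrak d)$. A *CC-morphism* from a normal category $\mathcal C$ to a normal category $\mathcal C'$ is a pair $(F,G)$ of a functor $F\colon\mathcal C\to\mathcal C'$ that maps inclusions to inclusions and an order preserving map $G\colon\widehat{\mathcal C}/\mathscr R\to\widehat{\mathcal C'}/\mathscr R$ such that, whenever $c$ is connected by $\mathfrak d$, the object $F(c)$ is connected by $G(\mathfrak d)$ and $F(\epsilon(c,\mathfrak d)(c'))=\epsilon(F(c),G(\mathfrak d))(F(c'))$ for every object $c'$ of $\mathcal C$. **Theorem.** If $\mathcal C$ is a bounded above normal category, then the semigroup $\widehat{\mathcal C}$ of all cones in $\mathcal C$ is a regular monoid. The category of regular monoids, with all semigroup homomorphisms as morphisms,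 is equivalent to the category of bounded above normal categories, with CC-morphisms as morphisms. -/

import Mathlib

open CategoryTheory

universe u v

namespace ConnCat

/-! ### Regular semigroups, the quasi-order `≤ᵣ` and the poset `S/ℛ` -/

/-- A semigroup is regular if every element has an inverse in the sense of von Neumann. -/
class IsRegularSemigroup (S : Type u) [Semigroup S] : Prop where
  exists_inverse : ∀ a : S, ∃ x : S, a * x * a = a ∧ x * a * x = x

/-- The quasi-order `a ≤ᵣ b ↔ a ∈ bS` of a regular semigroup `S`. -/
abbrev greenR (S : Type u) [Semigroup S] [IsRegularSemigroup S] : Preorder S where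
  le a b := ∃ x : S, a = b * x
  le_refl a := by
    obtain ⟨x, hx, -⟩ := IsRegularSemigroup.exists_inverse a
    exact ⟨x * a, by rw [← mul_assoc, hx]⟩
  le_trans a b c := by
    rintro ⟨x, rfl⟩ ⟨y, rfl⟩
    exact ⟨y * x, by rw [mul_assoc]⟩

/-- The set `S/ℛ` of `ℛ`-classes, where `ℛ` is `≤ᵣ` intersected with its converse. -/
def RClasses (S : Type u) [Semigroup S] [IsRegularSemigroup S] : Type u :=
  @Antisymmetrization S (greenR S).le _

/-- `S/ℛ` is partially ordered by `R_a ⊑ R_b ↔ a ≤ᵣ b`. -/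
instance (S : Type u) [Semigroup S] [IsRegularSemigroup S] : PartialOrder (RClasses S) :=
  @instPartialOrderAntisymmetrization S (greenR S)

/-- The `ℛ`-class `R_a`. -/
def RClasses.mk {S : Type u} [Semigroup S] [IsRegularSemigroup S] (a : S) : RClasses S :=
  @toAntisymmetrization S (greenR S).le _ a

theorem RClasses.mk_le_mk {S : Type u} [Semigroup S] [IsRegularSemigroup S] (a b : S) :
    RClasses.mk a ≤ RClasses.mk b ↔ ∃ x : S, a = b * x := Iff.rfl

/-! ### Categories with subobjects -/

/-- A category with subobjects: a wide subcategory of morphisms, called inclusions, which is a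
strict preorder (there is at most one inclusion between two objects, and two objects with
inclusions in both directions are equal), which consists of monomorphisms, and such that
`h ≫ g` and `g` being inclusions forces `h` to be one. -/
class SubobjectCategory (C : Type u) [Category.{v} C] where
  /-- The class of inclusions. -/
  incl : MorphismProperty C
  incl_id : ∀ a : C, incl (𝟙 a)
  incl_comp : ∀ {a b c : C} (f : a ⟶ b) (g : b ⟶ c), incl f → incl g → incl (f ≫ g)
  incl_unique : ∀ {a b : C} (f g : a ⟶ b), incl f → incl g → f = g
  incl_antisymm : ∀ {a b : C} (f : a ⟶ b) (g : b ⟶ a), incl f → incl g → a = b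
  incl_mono : ∀ {a b : C} (f : a ⟶ b), incl f → Mono f
  incl_of_comp : ∀ {a b c : C} (h : a ⟶ b) (g : b ⟶ c), incl g → incl (h ≫ g) → incl h

section Subobjects

variable {C : Type u} [Category.{v} C] [SubobjectCategory C]

/-- `f` is an inclusion. -/
def Incl {a b : C} (f : a ⟶ b) : Prop := SubobjectCategory.incl f

/-- `a ⪯ b`: there is an inclusion from `a` to `b`. -/
def SubLE (a b : C) : Prop := ∃ j : a ⟶ b, Incl j

/-- A retraction: a right inverse of some inclusion. -/
def IsRetraction {a b : C} (q : a ⟶ b) : Prop := ∃ j : b ⟶ a, Incl j ∧ j ≫ q = 𝟙 b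

/-- A normal factorisation `f = q u j` into a retraction, an isomorphism and an inclusion. -/
structure NormalFactorisation {a b : C} (f : a ⟶ b) where
  /-- The coimage belonging to the factorisation. -/
  coim : C
  /-- The image belonging to the factorisation. -/
  im : C
  q : a ⟶ coim
  u : coim ⟶ im
  j : im ⟶ b
  retraction : IsRetraction q
  iso : IsIso u
  inclusion : Incl j
  fac : q ≫ u ≫ j = f

/-- A cone with vertex `z`: a family of morphisms `γ(c) : c ⟶ z`, compatible with the inclusions,
at least one of which is an isomorphism. -/
@[ext]
structure NormalCone (z : C) where
  app : ∀ c : C, c ⟶ z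
  naturality : ∀ {a b : C} (j : a ⟶ b), Incl j → j ≫ app b = app a
  exists_iso : ∃ c : C, IsIso (app c)

end Subobjects

/-! ### Normal categories and their semigroups of cones -/

/-- A category with subobjects is normal if all inclusions split, every morphism has a normal
factorisation, and every object `c` is the vertex of a cone with component `𝟙 c` at `c`. -/
class IsNormalCategory (C : Type u) [Category.{v} C] [SubobjectCategory C] : Prop where
  splits : ∀ {a b : C} (j : a ⟶ b), Incl j → ∃ q : b ⟶ a, j ≫ q = 𝟙 a
  exists_normalFactorisation : ∀ {a b : C} (f : a ⟶ b), Nonempty (NormalFactorisation f)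
  exists_cone : ∀ c : C, ∃ μ : NormalCone c, μ.app c = 𝟙 c

section Normal

variable {C : Type u} [Category.{v} C] [SubobjectCategory C] [IsNormalCategory C]

/-- A chosen normal factorisation. The image `im f` and the epimorphic component `epiPart f`
below do not depend on the choice. -/
noncomputable def normalFactorisation {a b : C} (f : a ⟶ b) : NormalFactorisation f :=
  (IsNormalCategory.exists_normalFactorisation f).some

/-- The image of `f`. -/
noncomputable abbrev im {a b : C} (f : a ⟶ b) : C := (normalFactorisation f).im

/-- The epimorphic component `f°` of `f`. -/
noncomputable def epiPart {a b : C} (f : a ⟶ b) : a ⟶ im f :=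
  (normalFactorisation f).q ≫ (normalFactorisation f).u

/-- The inclusion `j_f` of `f`. -/
noncomputable def inclPart {a b : C} (f : a ⟶ b) : im f ⟶ b := (normalFactorisation f).j

theorem inclPart_incl {a b : C} (f : a ⟶ b) : Incl (inclPart f) :=
  (normalFactorisation f).inclusion

theorem epiPart_inclPart {a b : C} (f : a ⟶ b) : epiPart f ≫ inclPart f = f := by
  rw [epiPart, inclPart, Category.assoc, (normalFactorisation f).fac]

theorem exists_section_epiPart {a b : C} (f : a ⟶ b) :
    ∃ s : im f ⟶ a, s ≫ epiPart f = 𝟙 (im f) := by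
  obtain ⟨j, -, hj⟩ := (normalFactorisation f).retraction
  have : IsIso (normalFactorisation f).u := (normalFactorisation f).iso
  refine ⟨(inv (normalFactorisation f).u : (normalFactorisation f).im ⟶ _) ≫ j, ?_⟩
  rw [epiPart, Category.assoc, reassoc_of% hj, IsIso.inv_hom_id]

instance epi_epiPart {a b : C} (f : a ⟶ b) : Epi (epiPart f) := by
  obtain ⟨s, hs⟩ := exists_section_epiPart f
  exact (SplitEpi.mk s hs).epi

/-- The inclusion of an epimorphism is an isomorphism. -/
theorem isIso_inclPart {a b : C} (f : a ⟶ b) [Epi f] : IsIso (inclPart f) := by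
  obtain ⟨r, hr⟩ := IsNormalCategory.splits _ (inclPart_incl f)
  have : Epi (inclPart f) := by
    have : Epi (epiPart f ≫ inclPart f) := by rw [epiPart_inclPart]; infer_instance
    exact epi_of_epi (epiPart f) (inclPart f)
  have : IsSplitMono (inclPart f) := ⟨⟨⟨r, hr⟩⟩⟩
  exact isIso_of_epi_of_isSplitMono _

theorem exists_section_of_epi {a b : C} (f : a ⟶ b) [Epi f] : ∃ s : b ⟶ a, s ≫ f = 𝟙 b := by
  obtain ⟨s, hs⟩ := exists_section_epiPart f
  have := isIso_inclPart f
  refine ⟨inv (inclPart f) ≫ s, ?_⟩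
  rw [← cancel_mono (inv (inclPart f))]
  have : f ≫ inv (inclPart f) = epiPart f := by
    rw [IsIso.comp_inv_eq, epiPart_inclPart]
  simp [this, hs]

/-- The cone `γ ∗ f`, with components `γ(c) f`, for an epimorphism `f` out of the vertex. -/
def NormalCone.star {z w : C} (γ : NormalCone z) (f : z ⟶ w) [Epi f] : NormalCone w where
  app c := γ.app c ≫ f
  naturality j hj := by rw [← Category.assoc, γ.naturality j hj]
  exists_iso := by
    obtain ⟨c, hc⟩ := γ.exists_iso
    obtain ⟨s, hs⟩ := exists_section_of_epi f
    let m : w ⟶ c := s ≫ inv (γ.app c)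
    have hm : m ≫ γ.app c ≫ f = 𝟙 w := by simp [m, hs]
    have h1 : epiPart m ≫ γ.app (im m) ≫ f = 𝟙 w := by
      rw [← γ.naturality _ (inclPart_incl m), Category.assoc, ← Category.assoc,
        epiPart_inclPart, hm]
    have : IsSplitMono (epiPart m) := ⟨⟨⟨_, h1⟩⟩⟩
    have : IsIso (epiPart m) := isIso_of_epi_of_isSplitMono _
    refine ⟨im m, ?_⟩
    rw [IsIso.eq_inv_of_hom_inv_id h1]
    infer_instance

variable (C) in
/-- The set `Ĉ` of all cones in `C`: a vertex together with a cone with that vertex. -/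
structure Cones where
  vertex : C
  cone : NormalCone vertex

theorem Cones.star_congr {z w w' b : C} (γ : NormalCone z) (p : z ⟶ w) (p' : z ⟶ w') [Epi p]
    [Epi p'] (j : w ⟶ b) (j' : w' ⟶ b) (hj : Incl j) (hj' : Incl j') (h : p ≫ j = p' ≫ j') :
    (⟨w, γ.star p⟩ : Cones C) = ⟨w', γ.star p'⟩ := by
  obtain ⟨s, hs⟩ := exists_section_of_epi p
  obtain ⟨s', hs'⟩ := exists_section_of_epi p'
  have e1 : (s ≫ p') ≫ j' = j := by rw [Category.assoc, ← h, reassoc_of% hs]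
  have e2 : (s' ≫ p) ≫ j = j' := by rw [Category.assoc, h, reassoc_of% hs']
  obtain rfl : w = w' := SubobjectCategory.incl_antisymm (s ≫ p') (s' ≫ p)
    (SubobjectCategory.incl_of_comp _ j' hj' (by rw [e1]; exact hj))
    (SubobjectCategory.incl_of_comp _ j hj (by rw [e2]; exact hj'))
  obtain rfl := SubobjectCategory.incl_unique j j' hj hj'
  have := SubobjectCategory.incl_mono j hj
  obtain rfl : p = p' := (cancel_mono j).1 h
  rfl

/-- The product of cones `γ · δ = γ ∗ (δ(z_γ))°`. -/
noncomputable instance : Mul (Cones C) where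
  mul γ δ := ⟨im (δ.cone.app γ.vertex), γ.cone.star (epiPart (δ.cone.app γ.vertex))⟩

theorem Cones.mul_def (γ δ : Cones C) :
    γ * δ = ⟨im (δ.cone.app γ.vertex), γ.cone.star (epiPart (δ.cone.app γ.vertex))⟩ := rfl

/-- The semigroup `Ĉ` of all cones in a normal category. -/
noncomputable instance : Semigroup (Cones C) where
  mul_assoc α β γ := by
    have h : (α * β) * γ = ⟨_, α.cone.star (epiPart (β.cone.app α.vertex) ≫
        epiPart (γ.cone.app (im (β.cone.app α.vertex))))⟩ := by
      simp only [Cones.mul_def, NormalCone.star, Category.assoc]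
    rw [h]
    refine Cones.star_congr α.cone _ _ (inclPart _) (inclPart _ ≫ inclPart (γ.cone.app β.vertex))
      (inclPart_incl _)
      (SubobjectCategory.incl_comp _ _ (inclPart_incl _) (inclPart_incl _)) ?_
    rw [Category.assoc, epiPart_inclPart, ← Category.assoc, epiPart_inclPart]
    change _ = (β.cone.app α.vertex ≫ epiPart (γ.cone.app β.vertex)) ≫ _
    rw [Category.assoc, epiPart_inclPart, ← γ.cone.naturality _ (inclPart_incl (β.cone.app α.vertex)),
      ← Category.assoc, epiPart_inclPart]

theorem Cones.mul_of_epi (γ δ : Cones C) [Epi (δ.cone.app γ.vertex)] :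
    γ * δ = ⟨δ.vertex, γ.cone.star (δ.cone.app γ.vertex)⟩ :=
  Cones.star_congr γ.cone _ _ (inclPart _) (𝟙 _) (inclPart_incl _) (SubobjectCategory.incl_id _)
    (by rw [epiPart_inclPart, Category.comp_id])

/-- The semigroup of cones is regular. -/
instance : IsRegularSemigroup (Cones C) where
  exists_inverse γ := by
    obtain ⟨z, γ⟩ := γ
    obtain ⟨d, hd⟩ := γ.exists_iso
    obtain ⟨μ, hμ⟩ := IsNormalCategory.exists_cone z
    let χ : Cones C := ⟨d, μ.star (inv (γ.app d))⟩
    have hχ : χ.cone.app z = inv (γ.app d) := by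
      change μ.app z ≫ inv (γ.app d) = _
      rw [hμ, Category.id_comp]
    have : IsIso (χ.cone.app z) := by rw [hχ]; infer_instance
    have h1 : (⟨z, γ⟩ : Cones C) * χ = ⟨d, γ.star (inv (γ.app d))⟩ := by
      have : Epi (χ.cone.app (⟨z, γ⟩ : Cones C).vertex) := by
        change Epi (χ.cone.app z); infer_instance
      rw [Cones.mul_of_epi]
      simp only [NormalCone.star, hχ]
      rfl
    have : Epi ((⟨z, γ⟩ : Cones C).cone.app χ.vertex) := by
      change Epi (γ.app d); infer_instance
    have h2 : χ * (⟨z, γ⟩ : Cones C) = ⟨z, μ⟩ := by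
      rw [Cones.mul_of_epi]
      simp [NormalCone.star, χ]
    refine ⟨χ, ?_, ?_⟩
    · rw [mul_assoc, h2]
      have : Epi ((⟨z, μ⟩ : Cones C).cone.app (⟨z, γ⟩ : Cones C).vertex) := by
        change Epi (μ.app z); rw [hμ]; infer_instance
      rw [Cones.mul_of_epi]
      simp [NormalCone.star, hμ]
    · rw [h2]
      have : Epi (χ.cone.app (⟨z, μ⟩ : Cones C).vertex) := by
        change Epi (χ.cone.app z); infer_instance
      rw [Cones.mul_of_epi]
      simp only [NormalCone.star, hχ]
      rfl

/-- `ε` is the idempotent cone `ε(c, 𝔡)`: it is idempotent, its vertex is `c` and its `ℛ`-class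
is `𝔡`. -/
def IsIdempotentConeOf {c : C} (ε : NormalCone c) (d : RClasses (Cones C)) : Prop :=
  IsIdempotentElem (⟨c, ε⟩ : Cones C) ∧ RClasses.mk (⟨c, ε⟩ : Cones C) = d

theorem NormalCone.comp_eq_id_of_star_eq {c w : C} (ε : NormalCone c) (p : c ⟶ w) [Epi p]
    (j : w ⟶ c) (hj : Incl j) (h : (⟨w, ε.star p⟩ : Cones C) = ⟨c, ε⟩) : p ≫ j = 𝟙 c := by
  obtain ⟨rfl, h'⟩ := (Cones.mk.injEq ..).mp h
  obtain rfl := SubobjectCategory.incl_unique j (𝟙 _) hj (SubobjectCategory.incl_id _)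
  obtain ⟨d, hd⟩ := ε.exists_iso
  have h2 : ε.app d ≫ p = ε.app d := congrArg (fun γ => NormalCone.app γ d) (eq_of_heq h')
  rw [Category.comp_id, ← cancel_epi (ε.app d), h2, Category.comp_id]

/-- A cone with vertex `c` is idempotent if and only if its component at `c` is the identity. -/
theorem isIdempotentElem_cone_iff {c : C} (ε : NormalCone c) :
    IsIdempotentElem (⟨c, ε⟩ : Cones C) ↔ ε.app c = 𝟙 c := by
  constructor
  · intro h
    rw [← epiPart_inclPart (ε.app c)]
    exact ε.comp_eq_id_of_star_eq _ _ (inclPart_incl _) h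
  · intro h
    have : Epi ((⟨c, ε⟩ : Cones C).cone.app (⟨c, ε⟩ : Cones C).vertex) := by
      change Epi (ε.app c); rw [h]; infer_instance
    rw [IsIdempotentElem, Cones.mul_of_epi]
    simp [NormalCone.star, h]

/-- The idempotent cone `ε(c, 𝔡)` is determined by `c` and `𝔡`. -/
theorem IsIdempotentConeOf.unique {c : C} {ε ε' : NormalCone c} {d : RClasses (Cones C)}
    (h : IsIdempotentConeOf ε d) (h' : IsIdempotentConeOf ε' d) : ε = ε' := by
  obtain ⟨x, hx⟩ := (RClasses.mk_le_mk (⟨c, ε⟩ : Cones C) ⟨c, ε'⟩).1 (h.2.trans h'.2.symm).le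
  have h1 : (⟨c, ε'⟩ : Cones C) * ⟨c, ε⟩ = ⟨c, ε⟩ := by
    rw [hx, ← mul_assoc, h'.1]
  have hε := (isIdempotentElem_cone_iff ε).1 h.1
  have : Epi ((⟨c, ε⟩ : Cones C).cone.app (⟨c, ε'⟩ : Cones C).vertex) := by
    change Epi (ε.app c); rw [hε]; infer_instance
  rw [Cones.mul_of_epi] at h1
  have h2 := eq_of_heq ((Cones.mk.injEq ..).mp h1).2
  rw [← h2]
  simp [NormalCone.star, hε]

/-- The object `c` is connected by `𝔡`: there is an idempotent cone in `𝔡` with vertex `c`. -/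
def IsConnectedBy (c : C) (d : RClasses (Cones C)) : Prop :=
  ∃ ε : NormalCone c, IsIdempotentConeOf ε d

end Normal

/-! ### Connected categories and CC-morphisms -/

/-- A connected category `C_𝔇`: a small normal category `C` with a down-set `𝔇` of `Ĉ/ℛ` such that
every object of `C` is connected by some member of `𝔇`. -/
structure ConnectedCategory where
  carrier : Type u
  [cat : SmallCategory carrier]
  [subobjects : SubobjectCategory carrier]
  [normal : IsNormalCategory carrier]
  downSet : LowerSet (RClasses (Cones carrier))
  connected : ∀ c : carrier, ∃ d ∈ downSet, IsConnectedBy c d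

attribute [instance] ConnectedCategory.cat ConnectedCategory.subobjects ConnectedCategory.normal

/-- A CC-morphism `(F, G)` between connected categories. -/
@[ext]
structure CCHom (X Y : ConnectedCategory.{u}) where
  F : X.carrier ⥤ Y.carrier
  G : X.downSet →o Y.downSet
  map_incl : ∀ {a b : X.carrier} (j : a ⟶ b), Incl j → Incl (F.map j)
  map_connected : ∀ (c : X.carrier) (d : X.downSet),
    IsConnectedBy c d.1 → IsConnectedBy (F.obj c) (G d).1
  map_cone : ∀ (c : X.carrier) (d : X.downSet) (ε : NormalCone c) (ε' : NormalCone (F.obj c)),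
    IsIdempotentConeOf ε d.1 → IsIdempotentConeOf ε' (G d).1 →
      ∀ c' : X.carrier, F.map (ε.app c') = ε'.app (F.obj c')

/-- The identity CC-morphism. -/
noncomputable def CCHom.id (X : ConnectedCategory.{u}) : CCHom X X where
  F := 𝟭 _
  G := OrderHom.id
  map_incl _ hj := hj
  map_connected _ _ h := h
  map_cone _ _ _ _ hε hε' c' := congrArg (fun γ => NormalCone.app γ c') (hε.unique hε')

/-- Composition of CC-morphisms. -/
noncomputable def CCHom.comp {X Y Z : ConnectedCategory.{u}} (m : CCHom X Y) (n : CCHom Y Z) : CCHom X Z where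
  F := m.F ⋙ n.F
  G := n.G.comp m.G
  map_incl _ hj := n.map_incl _ (m.map_incl _ hj)
  map_connected _ _ h := n.map_connected _ _ (m.map_connected _ _ h)
  map_cone c d ε ε'' hε hε'' c' := by
    obtain ⟨ε', hε'⟩ := m.map_connected c d ⟨ε, hε⟩
    exact (congrArg n.F.map (m.map_cone c d ε ε' hε hε' c')).trans
      (n.map_cone _ _ ε' ε'' hε' hε'' _)

/-- The category `CC` of connected categories and CC-morphisms. -/
noncomputable instance : Category ConnectedCategory.{u} where
  Hom := CCHom
  id := CCHom.id
  comp := CCHom.comp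

/-- A category with subobjects is bounded above if it has a largest object. -/
def IsBoundedAbove (C : Type u) [Category.{v} C] [SubobjectCategory C] : Prop :=
  ∃ k : C, ∀ c : C, SubLE c k

/-- A normal category is regarded as the connected category with `𝔇 = Ĉ/ℛ`. This property of a
connected category says that it is a bounded above normal category in this sense. -/
def isBoundedAboveNormal : ObjectProperty ConnectedCategory.{u} :=
  fun X => X.downSet = ⊤ ∧ IsBoundedAbove X.carrier

/-- The category of bounded above normal categories with CC-morphisms, a full subcategory of the
category of connected categories. -/
abbrev BoundedAboveNormalCategory : Type (u + 1) :=
  (isBoundedAboveNormal.{u}).FullSubcategory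

/-- A regular semigroup with an identity element. -/
def IsRegularMonoid (S : Type u) [Semigroup S] : Prop :=
  IsRegularSemigroup S ∧ ∃ e : S, ∀ a : S, e * a = a ∧ a * e = a

/-- The property of a semigroup of being a regular monoid. -/
def isRegularMonoid : ObjectProperty Semigrp.{u} := fun S => IsRegularMonoid S

/-- The category of regular monoids, a full subcategory of the category of semigroups: its
morphisms are the semigroup homomorphisms. -/
abbrev RegularMonoid : Type (u + 1) := (isRegularMonoid.{u}).FullSubcategory

end ConnCat

/-!
If `k` is the largest object of `C`, the inclusions into `k` form a cone, and this cone is an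
identity element of `Ĉ`.

A cone is determined by its `ℛ`-class together with one invertible component, and a morphism
`f : a ⟶ b` is encoded by the cone `ε ∗ f°`, where `ε` is an idempotent cone at `a`. So a
CC-morphism `(F, G)` carries a cone `γ` to the cone in `G(R_γ)` with components `F(γ(c))`, and every
semigroup homomorphism between cones arises from a unique CC-morphism: `C ↦ Ĉ` is fully faithful. A
regular monoid `M` lies in its essential image, because the right translations by `a` form a cone
with vertex `Ma` in the category of principal left ideals of `M`, and when `M` has an identity
element every cone is of this form: it is the translation by the image of `1`.
-/

namespace ConnCat

section RegularSemigroups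

variable {S : Type*} [Semigroup S] [IsRegularSemigroup S]

theorem RClasses.mk_surjective : Function.Surjective (RClasses.mk : S → RClasses S) :=
  Quot.mk_surjective

theorem RClasses.mk_mul_le (a b : S) : RClasses.mk (a * b) ≤ RClasses.mk a :=
  (RClasses.mk_le_mk _ _).2 ⟨b, rfl⟩

end RegularSemigroups

theorem IsRegularMonoid.of_surjective {S T : Type*} [Semigroup S] [Semigroup T]
    (hS : IsRegularMonoid S) (f : S →ₙ* T) (hf : Function.Surjective f) : IsRegularMonoid T := by
  obtain ⟨hS, e, he⟩ := hS
  refine ⟨⟨fun b => ?_⟩, f e, fun b => ?_⟩ <;> obtain ⟨a, rfl⟩ := hf b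
  · obtain ⟨x, hax, hxa⟩ := IsRegularSemigroup.exists_inverse a
    exact ⟨f x, by simp only [← map_mul, hax], by simp only [← map_mul, hxa]⟩
  · simp only [← map_mul, he, and_self]

/-! ### Cones in a normal category -/

section NormalCategories

variable {C : Type u} [Category.{v} C] [SubobjectCategory C]

theorem SubLE.antisymm {a b : C} : SubLE a b → SubLE b a → a = b := by
  rintro ⟨f, hf⟩ ⟨g, hg⟩
  exact SubobjectCategory.incl_antisymm f g hf hg

theorem incl_id (a : C) : Incl (𝟙 a) := SubobjectCategory.incl_id a

theorem NormalCone.app_eq_of_incl {a c : C} {ε : NormalCone c} (hε : ε.app c = 𝟙 c) (j : a ⟶ c)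
    (hj : Incl j) : ε.app a = j := by
  rw [← ε.naturality j hj, hε, Category.comp_id]

theorem Cones.exists_eq_mk {γ : Cones C} {z : C} (h : γ.vertex = z) :
    ∃ δ : NormalCone z, γ = ⟨z, δ⟩ := by
  subst h
  exact ⟨γ.cone, rfl⟩

variable [IsNormalCategory C]

instance : SplitEpiCategory C where
  isSplitEpi_of_epi f _ :=
    let ⟨s, hs⟩ := exists_section_of_epi f
    ⟨⟨⟨s, hs⟩⟩⟩

instance {D E : Type*} [Category* D] [Category* E] [SplitEpiCategory D] (F : D ⥤ E) :
    F.PreservesEpimorphisms where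
  preserves f _ :=
    have := isSplitEpi_of_epi f
    inferInstance

@[simp]
theorem NormalCone.star_app {z w : C} (γ : NormalCone z) (f : z ⟶ w) [Epi f] (c : C) :
    (γ.star f).app c = γ.app c ≫ f := rfl

theorem NormalCone.star_id {z : C} (γ : NormalCone z) : γ.star (𝟙 z) = γ := by
  ext c
  simp

namespace Cones

theorem mul_eq_star (γ δ : Cones C) {w : C} (p : γ.vertex ⟶ w) [Epi p] (j : w ⟶ δ.vertex)
    (hj : Incl j) (h : p ≫ j = δ.cone.app γ.vertex) : γ * δ = ⟨w, γ.cone.star p⟩ :=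
  star_congr γ.cone _ p (inclPart _) j (inclPart_incl _) hj ((epiPart_inclPart _).trans h.symm)

theorem subLE_vertex_mul (γ δ : Cones C) : SubLE (γ * δ).vertex δ.vertex :=
  ⟨inclPart _, inclPart_incl _⟩

theorem mul_eq_left (γ : Cones C) {c : C} (j : γ.vertex ⟶ c) (hj : Incl j) {ε : NormalCone c}
    (hε : ε.app c = 𝟙 c) : γ * ⟨c, ε⟩ = γ := by
  have h : γ * ⟨c, ε⟩ = ⟨γ.vertex, γ.cone.star (𝟙 _)⟩ :=
    mul_eq_star γ ⟨c, ε⟩ (𝟙 _) j hj ((Category.id_comp j).trans (ε.app_eq_of_incl hε j hj).symm)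
  rw [h, NormalCone.star_id]

theorem mk_mul_mk_star {z w : C} (γ : NormalCone z) {μ : NormalCone z} (hμ : μ.app z = 𝟙 z)
    (p : z ⟶ w) [Epi p] : (⟨z, γ⟩ * ⟨w, μ.star p⟩ : Cones C) = ⟨w, γ.star p⟩ :=
  mul_eq_star ⟨z, γ⟩ ⟨w, μ.star p⟩ p (𝟙 w) (incl_id w) (by simp [hμ])

theorem mk_le_mk_iff {z w : C} {α : NormalCone w} {γ : NormalCone z} :
    RClasses.mk (⟨w, α⟩ : Cones C) ≤ RClasses.mk ⟨z, γ⟩ ↔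
      ∃ (p : z ⟶ w) (_ : Epi p), α = γ.star p := by
  rw [RClasses.mk_le_mk]
  constructor
  · rintro ⟨δ, h⟩
    obtain ⟨rfl, h⟩ := (Cones.mk.injEq ..).mp h
    exact ⟨_, inferInstance, eq_of_heq h⟩
  · rintro ⟨p, _, rfl⟩
    obtain ⟨μ, hμ⟩ := IsNormalCategory.exists_cone z
    exact ⟨⟨w, μ.star p⟩, (mk_mul_mk_star γ hμ p).symm⟩

theorem mk_star_le {z w : C} (γ : NormalCone z) (p : z ⟶ w) [Epi p] :
    RClasses.mk (⟨w, γ.star p⟩ : Cones C) ≤ RClasses.mk ⟨z, γ⟩ :=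
  mk_le_mk_iff.2 ⟨p, inferInstance, rfl⟩

theorem mk_star_of_isIso {z w : C} (γ : NormalCone z) (u : z ⟶ w) [IsIso u] :
    RClasses.mk (⟨w, γ.star u⟩ : Cones C) = RClasses.mk ⟨z, γ⟩ :=
  (mk_star_le γ u).antisymm (mk_le_mk_iff.2 ⟨inv u, inferInstance, by ext c; simp⟩)

theorem mul_app_comp_app (γ δ ζ : Cones C) (c : C) :
    (γ * δ).cone.app c ≫ ζ.cone.app (γ * δ).vertex =
      γ.cone.app c ≫ δ.cone.app γ.vertex ≫ ζ.cone.app δ.vertex := by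
  let f := δ.cone.app γ.vertex
  change (γ.cone.app c ≫ epiPart f) ≫ ζ.cone.app (im f) = γ.cone.app c ≫ f ≫ _
  rw [← ζ.cone.naturality _ (inclPart_incl f), Category.assoc, ← Category.assoc (epiPart f),
    epiPart_inclPart]

theorem app_vertex_of_isIdempotentElem {ε : Cones C} (hε : IsIdempotentElem ε) :
    ε.cone.app ε.vertex = 𝟙 ε.vertex :=
  (isIdempotentElem_cone_iff ε.cone).1 hε

theorem incl_app_of_mul_eq_left {γ ε : Cones C} (hε : IsIdempotentElem ε) (h : γ * ε = γ) :
    Incl (ε.cone.app γ.vertex) := by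
  obtain ⟨j, hj⟩ : SubLE γ.vertex ε.vertex := h ▸ subLE_vertex_mul γ ε
  rwa [ε.cone.app_eq_of_incl (app_vertex_of_isIdempotentElem hε) j hj]

end Cones

namespace NormalCone

theorem eq_star_of_mk_le {z w c : C} {α : NormalCone w} {γ : NormalCone z}
    (h : RClasses.mk (⟨w, α⟩ : Cones C) ≤ RClasses.mk ⟨z, γ⟩) [IsIso (γ.app c)] (p : z ⟶ w)
    [Epi p] (hc : α.app c = γ.app c ≫ p) : α = γ.star p := by
  obtain ⟨q, _, rfl⟩ := Cones.mk_le_mk_iff.1 h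
  obtain rfl : q = p := (cancel_epi (γ.app c)).1 hc
  rfl

theorem eq_of_mk_eq {z c : C} {α γ : NormalCone z}
    (h : RClasses.mk (⟨z, α⟩ : Cones C) = RClasses.mk ⟨z, γ⟩) [IsIso (γ.app c)]
    (hc : α.app c = γ.app c) : α = γ := by
  rw [eq_star_of_mk_le h.le (𝟙 z) (hc.trans (Category.comp_id _).symm), star_id]

theorem isIdempotentConeOf_star_inv {z c : C} (γ : NormalCone z) [IsIso (γ.app c)] :
    IsIdempotentConeOf (γ.star (inv (γ.app c))) (RClasses.mk (⟨z, γ⟩ : Cones C)) :=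
  ⟨(isIdempotentElem_cone_iff _).2 (IsIso.hom_inv_id _), Cones.mk_star_of_isIso _ _⟩

end NormalCone

theorem isRegularMonoid_cones (h : IsBoundedAbove C) : IsRegularMonoid (Cones C) := by
  obtain ⟨k, hk⟩ := h
  choose j hj using hk
  have hjk : j k = 𝟙 k := SubobjectCategory.incl_unique _ _ (hj k) (incl_id k)
  let ε : NormalCone k :=
    { app := j
      naturality i hi := SubobjectCategory.incl_unique _ _
        (SubobjectCategory.incl_comp _ _ hi (hj _)) (hj _)
      exists_iso := ⟨k, hjk ▸ inferInstance⟩ }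
  refine ⟨inferInstance, ⟨k, ε⟩, fun γ => ⟨?_, Cones.mul_eq_left γ (j γ.vertex) (hj _) hjk⟩⟩
  have hγ (c : C) : j c ≫ γ.cone.app k = γ.cone.app c := γ.cone.naturality (j c) (hj c)
  obtain ⟨d, hd⟩ := γ.cone.exists_iso
  have : Epi (γ.cone.app k) :=
    have : Epi (j d ≫ γ.cone.app k) := hγ d ▸ inferInstance
    epi_of_epi (j d) _
  calc (⟨k, ε⟩ : Cones C) * γ = ⟨γ.vertex, ε.star (γ.cone.app k)⟩ :=
        Cones.mul_eq_star ⟨k, ε⟩ γ (γ.cone.app k) (𝟙 _) (incl_id _) (Category.comp_id _)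
    _ = γ := congrArg (Cones.mk _) (NormalCone.ext (funext hγ))

end NormalCategories

/-! ### The semigroup of a connected category -/

namespace ConnectedCategory

variable (X : ConnectedCategory.{u})

/-- The semigroup of a connected category `C_𝔇`: the cones of `C` whose `ℛ`-class lies in `𝔇`. It
is all of `Ĉ` when `C_𝔇` stands for a normal category. -/
noncomputable def coneSemigroup : Subsemigroup (Cones X.carrier) where
  carrier := {γ | RClasses.mk γ ∈ X.downSet}
  mul_mem' hγ _ := X.downSet.lower (RClasses.mk_mul_le _ _) hγ

theorem mk_star_mem {z w : X.carrier} {γ : NormalCone z} (hγ : ⟨z, γ⟩ ∈ X.coneSemigroup)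
    (p : z ⟶ w) [Epi p] : ⟨w, γ.star p⟩ ∈ X.coneSemigroup :=
  X.downSet.lower (Cones.mk_star_le γ p) hγ

/-- The `ℛ`-class in `𝔇` of a member of the semigroup of `C_𝔇`. -/
noncomputable def rClass (γ : X.coneSemigroup) : X.downSet := ⟨RClasses.mk γ.1, γ.2⟩

theorem rClass_surjective : Function.Surjective X.rClass := by
  rintro ⟨d, hd⟩
  obtain ⟨γ, rfl⟩ := RClasses.mk_surjective d
  exact ⟨⟨γ, hd⟩, rfl⟩

theorem exists_idempotent_cone (c : X.carrier) :
    ∃ ε : NormalCone c, ε.app c = 𝟙 c ∧ ⟨c, ε⟩ ∈ X.coneSemigroup := by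
  obtain ⟨d, hd, ε, hε, rfl⟩ := X.connected c
  exact ⟨ε, (isIdempotentElem_cone_iff ε).1 hε, hd⟩

/-- A chosen idempotent cone with vertex `c` in the semigroup of `C_𝔇`. -/
noncomputable def idCone (c : X.carrier) : NormalCone c := (X.exists_idempotent_cone c).choose

@[simp]
theorem idCone_app (c : X.carrier) : (X.idCone c).app c = 𝟙 c :=
  (X.exists_idempotent_cone c).choose_spec.1

/-- The chosen idempotent cone with vertex `c`, as a member of the semigroup of `C_𝔇`. -/
noncomputable def idempotent (c : X.carrier) : X.coneSemigroup :=
  ⟨⟨c, X.idCone c⟩, (X.exists_idempotent_cone c).choose_spec.2⟩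

theorem isIdempotentElem_idempotent (c : X.carrier) : IsIdempotentElem (X.idempotent c) :=
  Subtype.ext ((isIdempotentElem_cone_iff _).2 (X.idCone_app c))

theorem mul_idempotent (γ : X.coneSemigroup) {c : X.carrier} (j : γ.1.vertex ⟶ c) (hj : Incl j) :
    γ * X.idempotent c = γ :=
  Subtype.ext (γ.1.mul_eq_left j hj (X.idCone_app c))

theorem exists_mul_eq_idempotent (γ : X.coneSemigroup) :
    ∃ χ, χ * γ = X.idempotent γ.1.vertex := by
  obtain ⟨⟨z, γ⟩, hγ⟩ := γ
  obtain ⟨d, hd⟩ := γ.exists_iso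
  refine ⟨⟨_, X.mk_star_mem (X.idempotent z).2 (inv (γ.app d))⟩, Subtype.ext ?_⟩
  refine (Cones.mul_eq_star _ ⟨z, γ⟩ (γ.app d) (𝟙 z) (incl_id z) (Category.comp_id _)).trans ?_
  exact congrArg (Cones.mk z) (by ext c; simp)

theorem rClass_le_iff {γ δ : X.coneSemigroup} :
    X.rClass γ ≤ X.rClass δ ↔ ∃ χ, γ = δ * χ := by
  constructor
  · obtain ⟨⟨w, γ⟩, hγ⟩ := γ
    obtain ⟨⟨z, δ⟩, hδ⟩ := δ
    intro h
    obtain ⟨p, _, rfl⟩ := Cones.mk_le_mk_iff.1 h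
    exact ⟨⟨_, X.mk_star_mem (X.idempotent z).2 p⟩,
      Subtype.ext (Cones.mk_mul_mk_star δ (X.idCone_app z) p).symm⟩
  · rintro ⟨χ, rfl⟩
    exact RClasses.mk_mul_le _ _

/-- The cone `ε ∗ f°`, where `ε` is the chosen idempotent cone at the domain of `f`. -/
noncomputable def homCone {a b : X.carrier} (f : a ⟶ b) : X.coneSemigroup :=
  ⟨_, X.mk_star_mem (X.idempotent a).2 (epiPart f)⟩

theorem idempotent_mul {a z : X.carrier} {γ : NormalCone z} (hγ : ⟨z, γ⟩ ∈ X.coneSemigroup) :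
    X.idempotent a * ⟨_, hγ⟩ = X.homCone (γ.app a) := rfl

theorem homCone_eq {a b w : X.carrier} (p : a ⟶ w) [Epi p] (j : w ⟶ b) (hj : Incl j) :
    X.homCone (p ≫ j) = ⟨_, X.mk_star_mem (X.idempotent a).2 p⟩ :=
  Subtype.ext (Cones.star_congr _ _ p (inclPart _) j (inclPart_incl _) hj (epiPart_inclPart _))

theorem homCone_of_incl {a b : X.carrier} (j : a ⟶ b) (hj : Incl j) :
    X.homCone j = X.idempotent a := by
  have h := X.homCone_eq (𝟙 a) j hj
  simp only [Category.id_comp, NormalCone.star_id] at h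
  exact h

theorem homCone_mul_idempotent {a b : X.carrier} (f : a ⟶ b) :
    X.homCone f * X.idempotent b = X.homCone f :=
  X.mul_idempotent _ (inclPart f) (inclPart_incl f)

theorem idCone_app_vertex_homCone {a b : X.carrier} (f : a ⟶ b) :
    (X.idCone b).app (X.homCone f).1.vertex = inclPart f :=
  (X.idCone b).app_eq_of_incl (X.idCone_app b) _ (inclPart_incl f)

theorem homCone_app_comp_idCone_app {a b : X.carrier} (f : a ⟶ b) :
    (X.homCone f).1.cone.app a ≫ (X.idCone b).app (X.homCone f).1.vertex = f := by
  rw [idCone_app_vertex_homCone]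
  simp [homCone, epiPart_inclPart]

theorem homCone_comp {a b c : X.carrier} (f : a ⟶ b) (g : b ⟶ c) :
    X.homCone (f ≫ g) = X.homCone f * X.homCone g := by
  let e := inclPart f ≫ epiPart g
  have he : (X.homCone g).1.cone.app (im f) = e :=
    congrArg (· ≫ epiPart g) (X.idCone_app_vertex_homCone f)
  have hfg : f ≫ g = (epiPart f ≫ epiPart e) ≫ inclPart e ≫ inclPart g := by
    simp only [Category.assoc, reassoc_of% epiPart_inclPart e]
    simp only [e, Category.assoc, epiPart_inclPart, reassoc_of% epiPart_inclPart f]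
  rw [hfg, X.homCone_eq _ _ (SubobjectCategory.incl_comp _ _ (inclPart_incl e) (inclPart_incl g))]
  refine Subtype.ext (Eq.symm ?_)
  refine (Cones.mul_eq_star ⟨im f, _⟩ (X.homCone g).1 (epiPart e) (inclPart e) (inclPart_incl e)
    ((epiPart_inclPart e).trans he.symm)).trans (congrArg (Cones.mk _) ?_)
  ext x
  simp

/-- When `𝔇` is all of `Ĉ/ℛ`, the semigroup of `C_𝔇` is `Ĉ`. -/
noncomputable def coneSemigroupEquiv (hX : X.downSet = ⊤) :
    X.coneSemigroup ≃* Cones X.carrier :=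
  have h : X.coneSemigroup = ⊤ := top_unique fun γ _ => hX.ge (Set.mem_univ (RClasses.mk γ))
  (MulEquiv.subsemigroupCongr h).trans Subsemigroup.topEquiv

end ConnectedCategory

/-! ### CC-morphisms and homomorphisms between the semigroups of cones -/

namespace CCHom

variable {X Y : ConnectedCategory.{u}} (m : CCHom X Y)

theorem exists_mapCone (γ : X.coneSemigroup) :
    ∃ δ : NormalCone (m.F.obj γ.1.vertex), RClasses.mk ⟨_, δ⟩ = (m.G (X.rClass γ)).1 ∧
      ∀ c, δ.app (m.F.obj c) = m.F.map (γ.1.cone.app c) := by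
  obtain ⟨c, hc⟩ := γ.1.cone.exists_iso
  have hε := γ.1.cone.isIdempotentConeOf_star_inv (c := c)
  obtain ⟨ε', hε'⟩ := m.map_connected c (X.rClass γ) ⟨_, hε⟩
  refine ⟨ε'.star (m.F.map (γ.1.cone.app c)), (Cones.mk_star_of_isIso _ _).trans hε'.2,
    fun c' => ?_⟩
  rw [NormalCone.star_app, ← m.map_cone c (X.rClass γ) _ ε' hε hε', ← m.F.map_comp]
  simp

/-- The image of a cone `γ` under a CC-morphism `(F, G)`: the cone in the `ℛ`-class `G(R_γ)` with
components `F(γ(c))` at the objects `F(c)`. -/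
noncomputable def mapCone (γ : X.coneSemigroup) : NormalCone (m.F.obj γ.1.vertex) :=
  (m.exists_mapCone γ).choose

theorem mk_mapCone (γ : X.coneSemigroup) :
    RClasses.mk ⟨_, m.mapCone γ⟩ = (m.G (X.rClass γ)).1 :=
  (m.exists_mapCone γ).choose_spec.1

@[simp]
theorem mapCone_app (γ : X.coneSemigroup) (c : X.carrier) :
    (m.mapCone γ).app (m.F.obj c) = m.F.map (γ.1.cone.app c) :=
  (m.exists_mapCone γ).choose_spec.2 c

theorem eq_mapCone {γ : X.coneSemigroup} {δ : NormalCone (m.F.obj γ.1.vertex)}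
    (hδ : RClasses.mk ⟨_, δ⟩ = (m.G (X.rClass γ)).1)
    (happ : ∀ c, δ.app (m.F.obj c) = m.F.map (γ.1.cone.app c)) : δ = m.mapCone γ := by
  obtain ⟨c, hc⟩ := γ.1.cone.exists_iso
  have : IsIso ((m.mapCone γ).app (m.F.obj c)) := m.mapCone_app γ c ▸ inferInstance
  exact NormalCone.eq_of_mk_eq (hδ.trans (m.mk_mapCone γ).symm)
    ((happ c).trans (m.mapCone_app γ c).symm)

theorem mapCone_star {z w : X.carrier} {γ : NormalCone z} (hγ : ⟨z, γ⟩ ∈ X.coneSemigroup)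
    (p : z ⟶ w) [Epi p] :
    m.mapCone ⟨_, X.mk_star_mem hγ p⟩ = (m.mapCone ⟨_, hγ⟩).star (m.F.map p) := by
  obtain ⟨c, hc⟩ := γ.exists_iso
  have : IsIso ((m.mapCone ⟨_, hγ⟩).app (m.F.obj c)) := m.mapCone_app _ c ▸ inferInstance
  refine NormalCone.eq_star_of_mk_le (c := m.F.obj c) ?_ _ (by simp)
  rw [mk_mapCone, mk_mapCone]
  exact m.G.monotone (Cones.mk_star_le γ p)

/-- The homomorphism between the semigroups of cones induced by a CC-morphism. -/
noncomputable def mapCones : X.coneSemigroup →ₙ* Y.coneSemigroup where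
  toFun γ := ⟨⟨_, m.mapCone γ⟩, show RClasses.mk _ ∈ _ from m.mk_mapCone γ ▸ (m.G _).2⟩
  map_mul' γ δ := by
    let f := δ.1.cone.app γ.1.vertex
    have hf : m.F.map (epiPart f) ≫ m.F.map (inclPart f) =
        (m.mapCone δ).app (m.F.obj γ.1.vertex) := by
      rw [← m.F.map_comp, epiPart_inclPart, mapCone_app]
    refine Subtype.ext ((congrArg (Cones.mk _) (m.mapCone_star γ.2 (epiPart f))).trans ?_)
    exact (Cones.mul_eq_star ⟨_, m.mapCone γ⟩ ⟨_, m.mapCone δ⟩ _ _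
      (m.map_incl _ (inclPart_incl f)) hf).symm

theorem rClass_mapCones (γ : X.coneSemigroup) : Y.rClass (m.mapCones γ) = m.G (X.rClass γ) :=
  Subtype.ext (m.mk_mapCone γ)

theorem mapCones_id : (CCHom.id X).mapCones = MulHom.id _ := by
  ext γ
  exact congrArg (Cones.mk _) ((CCHom.id X).eq_mapCone rfl fun _ => rfl).symm

theorem mapCones_comp {Z : ConnectedCategory.{u}} (n : CCHom Y Z) :
    (m.comp n).mapCones = n.mapCones.comp m.mapCones := by
  ext γ
  refine congrArg (Cones.mk _) ((m.comp n).eq_mapCone (δ := n.mapCone (m.mapCones γ)) ?_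
    fun c => ?_).symm
  · exact (n.mk_mapCone _).trans (congrArg (fun d => (n.G d).1) (m.rClass_mapCones γ))
  · exact (n.mapCone_app _ _).trans (congrArg n.F.map (m.mapCone_app γ c))

end CCHom

section HomToCCHom

variable {X Y : ConnectedCategory.{u}} (h : X.coneSemigroup →ₙ* Y.coneSemigroup)

theorem rClass_map_le {γ δ : X.coneSemigroup} (hγδ : X.rClass γ ≤ X.rClass δ) :
    Y.rClass (h γ) ≤ Y.rClass (h δ) := by
  obtain ⟨χ, rfl⟩ := X.rClass_le_iff.1 hγδ
  exact Y.rClass_le_iff.2 ⟨h χ, map_mul h δ χ⟩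

/-- The order preserving map between the sets of `ℛ`-classes induced by a homomorphism. -/
noncomputable def mapRClass : X.downSet →o Y.downSet where
  toFun d := Y.rClass (h (Function.surjInv X.rClass_surjective d))
  monotone' d d' hd := rClass_map_le h <| by
    simpa only [Function.surjInv_eq X.rClass_surjective] using hd

theorem mapRClass_rClass (γ : X.coneSemigroup) : mapRClass h (X.rClass γ) = Y.rClass (h γ) :=
  have hγ := Function.surjInv_eq X.rClass_surjective (X.rClass γ)
  (rClass_map_le h hγ.le).antisymm (rClass_map_le h hγ.ge)

theorem vertex_map (γ : X.coneSemigroup) :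
    (h γ).1.vertex = (h (X.idempotent γ.1.vertex)).1.vertex := by
  obtain ⟨χ, hχ⟩ := X.exists_mul_eq_idempotent γ
  apply SubLE.antisymm
  · have := Cones.subLE_vertex_mul (h γ).1 (h (X.idempotent γ.1.vertex)).1
    rwa [← MulMemClass.coe_mul, ← map_mul, X.mul_idempotent γ (𝟙 _) (incl_id _)] at this
  · have := Cones.subLE_vertex_mul (h χ).1 (h γ).1
    rwa [← MulMemClass.coe_mul, ← map_mul, hχ] at this

theorem isIdempotentElem_map_idempotent (c : X.carrier) :
    IsIdempotentElem (h (X.idempotent c)).1 :=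
  congrArg Subtype.val ((X.isIdempotentElem_idempotent c).map h)

theorem incl_map_idempotent_app {γ : X.coneSemigroup} {c : X.carrier}
    (hγ : γ * X.idempotent c = γ) :
    Incl ((h (X.idempotent c)).1.cone.app (h γ).1.vertex) :=
  Cones.incl_app_of_mul_eq_left (isIdempotentElem_map_idempotent h c)
    (by rw [← MulMemClass.coe_mul, ← map_mul, hγ])

theorem map_idempotent_app_vertex (c : X.carrier) :
    (h (X.idempotent c)).1.cone.app (h (X.idempotent c)).1.vertex = 𝟙 _ :=
  Cones.app_vertex_of_isIdempotentElem (isIdempotentElem_map_idempotent h c)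

/-- The functor induced by a homomorphism `h`. It sends `c` to the vertex of the image of the
idempotent cone at `c`, and `f : a ⟶ b` to the component at that vertex of the image of the cone
`ε ∗ f°`, followed by an inclusion. -/
noncomputable def functorOfHom : X.carrier ⥤ Y.carrier where
  obj c := (h (X.idempotent c)).1.vertex
  map {a b} f := (h (X.homCone f)).1.cone.app (h (X.idempotent a)).1.vertex ≫
    (h (X.idempotent b)).1.cone.app (h (X.homCone f)).1.vertex
  map_id a := by
    rw [X.homCone_of_incl (𝟙 a) (incl_id a), map_idempotent_app_vertex, Category.comp_id]
  map_comp {a b c} f g := by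
    have hf := incl_map_idempotent_app h (X.homCone_mul_idempotent f)
    rw [X.homCone_comp, map_mul, MulMemClass.coe_mul, Cones.mul_app_comp_app, Category.assoc,
      reassoc_of% (h (X.homCone g)).1.cone.naturality _ hf]

theorem functorOfHom_map_app (γ : X.coneSemigroup) (c : X.carrier) :
    (functorOfHom h).map (γ.1.cone.app c) =
      (h γ).1.cone.app (h (X.idempotent c)).1.vertex ≫
        (h (X.idempotent γ.1.vertex)).1.cone.app (h γ).1.vertex := by
  dsimp only [functorOfHom]
  rw [← X.idempotent_mul γ.2, map_mul, MulMemClass.coe_mul, Cones.mul_app_comp_app,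
    map_idempotent_app_vertex, Category.id_comp]

theorem exists_map_eq_mk (γ : X.coneSemigroup) :
    ∃ δ : NormalCone ((functorOfHom h).obj γ.1.vertex), (h γ).1 = ⟨_, δ⟩ ∧
      ∀ c, δ.app ((functorOfHom h).obj c) = (functorOfHom h).map (γ.1.cone.app c) := by
  obtain ⟨δ, hδ⟩ := Cones.exists_eq_mk (vertex_map h γ)
  refine ⟨δ, hδ, fun c => ?_⟩
  rw [functorOfHom_map_app, hδ, map_idempotent_app_vertex, Category.comp_id]
  rfl

theorem exists_isIdempotentConeOf_mapRClass {c : X.carrier} {d : X.downSet} {ε : NormalCone c}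
    (hε : IsIdempotentConeOf ε d.1) :
    ∃ δ : NormalCone ((functorOfHom h).obj c), IsIdempotentConeOf δ (mapRClass h d).1 ∧
      ∀ c', (functorOfHom h).map (ε.app c') = δ.app ((functorOfHom h).obj c') := by
  obtain ⟨d, hd⟩ := d
  obtain ⟨hε, rfl⟩ := hε
  let γ : X.coneSemigroup := ⟨⟨c, ε⟩, hd⟩
  obtain ⟨δ, hδ, happ⟩ := exists_map_eq_mk h γ
  have hγ : IsIdempotentElem γ := Subtype.ext hε
  refine ⟨δ, ⟨hδ ▸ congrArg Subtype.val (hγ.map h), ?_⟩, fun c' => (happ c').symm⟩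
  exact (congrArg RClasses.mk hδ).symm.trans (congrArg Subtype.val (mapRClass_rClass h γ)).symm

/-- The CC-morphism induced by a homomorphism between the semigroups of cones. -/
noncomputable def ccHomOfHom : CCHom X Y where
  F := functorOfHom h
  G := mapRClass h
  map_incl {a b} j hj := by
    dsimp only [functorOfHom]
    have hab := incl_map_idempotent_app h (X.mul_idempotent (X.idempotent a) j hj)
    rwa [X.homCone_of_incl j hj, map_idempotent_app_vertex, Category.id_comp]
  map_connected c d := fun ⟨_, hε⟩ =>
    let ⟨δ, hδ, _⟩ := exists_isIdempotentConeOf_mapRClass h hε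
    ⟨δ, hδ⟩
  map_cone c d ε ε' hε hε' c' := by
    obtain ⟨δ, hδ, happ⟩ := exists_isIdempotentConeOf_mapRClass h hε
    rw [hε'.unique hδ, happ]

theorem mapCones_ccHomOfHom : (ccHomOfHom h).mapCones = h := by
  ext γ
  obtain ⟨δ, hδ, happ⟩ := exists_map_eq_mk h γ
  have hG : RClasses.mk ⟨_, δ⟩ = (mapRClass h (X.rClass γ)).1 :=
    (congrArg RClasses.mk hδ).symm.trans (congrArg Subtype.val (mapRClass_rClass h γ)).symm
  exact (congrArg (Cones.mk _) ((ccHomOfHom h).eq_mapCone hG happ).symm).trans hδ.symm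

theorem ccHomOfHom_mapCones (m : CCHom X Y) : ccHomOfHom m.mapCones = m := by
  refine CCHom.ext (CategoryTheory.Functor.ext (fun _ => rfl) fun a b f => ?_) ?_
  · have hf : (ccHomOfHom m.mapCones).F.map f = m.F.map f :=
      (congrArg₂ (· ≫ ·) (m.mapCone_app _ a) (m.mapCone_app _ _)).trans
        ((m.F.map_comp _ _).symm.trans (congrArg m.F.map (X.homCone_app_comp_idCone_app f)))
    exact hf.trans ((Category.id_comp _).trans (Category.comp_id _)).symm
  · ext d : 2
    obtain ⟨γ, rfl⟩ := X.rClass_surjective d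
    exact (mapRClass_rClass m.mapCones γ).trans (m.rClass_mapCones γ)

end HomToCCHom

/-- The functor `C_𝔇 ↦ {γ ∈ Ĉ | R_γ ∈ 𝔇}` from connected categories to semigroups. -/
noncomputable def coneSemigroupFunctor : ConnectedCategory.{u} ⥤ Semigrp.{u} where
  obj X := Semigrp.of X.coneSemigroup
  map m := Semigrp.ofHom (CCHom.mapCones m)
  map_id X := congrArg Semigrp.ofHom (CCHom.mapCones_id (X := X))
  map_comp m n := congrArg Semigrp.ofHom (CCHom.mapCones_comp m n)

/-- CC-morphisms correspond to homomorphisms between the semigroups of cones. -/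
noncomputable def coneSemigroupFunctorFullyFaithful : coneSemigroupFunctor.{u}.FullyFaithful where
  preimage h := ccHomOfHom h.hom
  map_preimage h := congrArg Semigrp.ofHom (mapCones_ccHomOfHom h.hom)
  preimage_map m := ccHomOfHom_mapCones m

instance : coneSemigroupFunctor.{u}.Full := coneSemigroupFunctorFullyFaithful.full

instance : coneSemigroupFunctor.{u}.Faithful := coneSemigroupFunctorFullyFaithful.faithful

theorem isRegularMonoid_coneSemigroup {X : ConnectedCategory.{u}} (hX : isBoundedAboveNormal X) :
    isRegularMonoid (coneSemigroupFunctor.obj X) :=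
  (isRegularMonoid_cones hX.2).of_surjective (X.coneSemigroupEquiv hX.1).symm.toMulHom
    (X.coneSemigroupEquiv hX.1).symm.surjective

/-- The functor sending a bounded above normal category to its monoid of cones. -/
noncomputable def conesFunctor : BoundedAboveNormalCategory.{u} ⥤ RegularMonoid.{u} :=
  isRegularMonoid.lift (isBoundedAboveNormal.ι ⋙ coneSemigroupFunctor)
    fun X => isRegularMonoid_coneSemigroup X.property

instance : conesFunctor.{u}.Full := inferInstanceAs (isRegularMonoid.lift _ _).Full

instance : conesFunctor.{u}.Faithful := inferInstanceAs (isRegularMonoid.lift _ _).Faithful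

/-! ### The category of principal left ideals of a regular semigroup -/

/-- A principal left ideal `Ma` of a semigroup `M`. -/
@[ext]
structure PrincipalLeftIdeal (M : Type u) [Semigroup M] where
  carrier : Set M
  exists_generator : ∃ a, carrier = Set.range (· * a)

namespace PrincipalLeftIdeal

section Semigroup

variable {M : Type u} [Semigroup M]

instance : SetLike (PrincipalLeftIdeal M) M where
  coe := carrier
  coe_injective _ _ := PrincipalLeftIdeal.ext

instance : PartialOrder (PrincipalLeftIdeal M) := .ofSetLike _ _

theorem mul_mem {I : PrincipalLeftIdeal M} (y : M) {x : M} (hx : x ∈ I) : y * x ∈ I := by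
  obtain ⟨_, a, rfl⟩ := I
  obtain ⟨z, rfl⟩ := hx
  exact ⟨y * z, mul_assoc y z a⟩

instance : SMulMemClass (PrincipalLeftIdeal M) M M where
  smul_mem y _ hx := mul_mem y hx

/-- The principal left ideal `Ma`. -/
def span (a : M) : PrincipalLeftIdeal M := ⟨Set.range (· * a), a, rfl⟩

theorem span_le {a : M} {I : PrincipalLeftIdeal M} (ha : a ∈ I) : span a ≤ I := by
  rintro _ ⟨y, rfl⟩
  exact mul_mem y ha

theorem mul_mem_span (x a : M) : x * a ∈ span a := ⟨x, rfl⟩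

/-- If `M` is regular, the morphisms are exactly the right translations `x ↦ xa`, because every
principal left ideal of `M` has a right identity element. -/
instance : SmallCategory (PrincipalLeftIdeal M) where
  Hom I J := I →[M] J
  id I := MulActionHom.id M
  comp φ ψ := ψ.comp φ

instance : ConcreteCategory (PrincipalLeftIdeal M) fun I J => I →[M] J where
  hom := id
  ofHom := id

variable {I J : PrincipalLeftIdeal M}

theorem hom_ext {φ ψ : I ⟶ J} (h : ∀ x : I, (φ x : M) = ψ x) : φ = ψ :=
  ConcreteCategory.hom_ext _ _ fun x => Subtype.ext (h x)

/-- The morphism `x ↦ xa`. -/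
def rightMul (a : M) (ha : ∀ x ∈ I, x * a ∈ J) : I ⟶ J where
  toFun x := ⟨x * a, ha x x.2⟩
  map_smul' y x := Subtype.ext (mul_assoc y x.1 a)

theorem isIso_rightMul_span {a b : M} (h : a * b * a = a) :
    IsIso (rightMul a fun x _ => mul_mem_span x a : span (a * b) ⟶ span a) := by
  have hz (z : M) : z * a * b * a = z * a := by rw [mul_assoc z, mul_assoc z, h]
  have hab : ∀ x ∈ span (a * b), x * a * b = x := by
    rintro _ ⟨z, rfl⟩
    simp only [← mul_assoc, hz]
  have hba : ∀ y ∈ span a, y * b * a = y := by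
    rintro _ ⟨z, rfl⟩
    exact hz z
  have hb : ∀ y ∈ span a, y * b ∈ span (a * b) := by
    rintro _ ⟨y, rfl⟩
    exact ⟨y, (mul_assoc y a b).symm⟩
  exact ⟨rightMul b hb, hom_ext fun x => hab x x.2, hom_ext fun y => hba y y.2⟩

theorem coe_apply_eq_mul (φ : I ⟶ J) {e : I} {x : I} (hx : (x : M) * e = x) :
    (φ x : M) = x * φ e := by
  have h : x = (x : M) • e := Subtype.ext hx.symm
  exact (congrArg (fun y => (φ y : M)) h).trans
    (congrArg Subtype.val (MulActionHom.map_smul φ (x : M) e))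

instance : SubobjectCategory (PrincipalLeftIdeal M) where
  incl I J φ := ∀ x : I, (φ x : M) = x
  incl_id _ _ := rfl
  incl_comp _ _ hφ hψ x := (hψ _).trans (hφ x)
  incl_unique _ _ hφ hψ := hom_ext fun x => (hφ x).trans (hψ x).symm
  incl_antisymm φ ψ hφ hψ := SetLike.ext fun x =>
    ⟨fun hx => (hφ ⟨x, hx⟩).subst (φ ⟨x, hx⟩).2, fun hx => (hψ ⟨x, hx⟩).subst (ψ ⟨x, hx⟩).2⟩
  incl_mono φ hφ := ConcreteCategory.mono_of_injective φ fun x y hxy =>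
    Subtype.ext (by rw [← hφ x, hxy, hφ y])
  incl_of_comp φ ψ hψ h x := (hψ (φ x)).symm.trans (h x)

/-- The inclusion `I ⊆ J`. -/
def inclusion (h : I ≤ J) : I ⟶ J where
  toFun x := ⟨x, h x.2⟩
  map_smul' _ _ := rfl

theorem incl_inclusion (h : I ≤ J) : Incl (inclusion h) := fun _ => rfl

variable [IsRegularSemigroup M]

theorem exists_right_identity (I : PrincipalLeftIdeal M) : ∃ e : I, ∀ x ∈ I, x * (e : M) = x := by
  obtain ⟨_, a, rfl⟩ := I
  obtain ⟨b, hab, -⟩ := IsRegularSemigroup.exists_inverse a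
  refine ⟨⟨b * a, mul_mem_span b a⟩, ?_⟩
  rintro _ ⟨x, rfl⟩
  change x * a * (b * a) = x * a
  rw [mul_assoc x, ← mul_assoc a, hab]

theorem exists_normalFactorisation (φ : I ⟶ J) : Nonempty (NormalFactorisation φ) := by
  obtain ⟨e, he⟩ := I.exists_right_identity
  obtain ⟨a, ha⟩ : ∃ a : M, a = φ e := ⟨_, rfl⟩
  have hφ (x : I) : (φ x : M) = x * a := ha ▸ coe_apply_eq_mul φ (he x x.2)
  have hea : (e : M) * a = a := (hφ e).symm.trans ha.symm
  obtain ⟨b, hbI, hab⟩ : ∃ b ∈ I, a * b * a = a := by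
    obtain ⟨b, hab, -⟩ := IsRegularSemigroup.exists_inverse a
    exact ⟨b * e, mul_mem b e.2, by rw [← mul_assoc, mul_assoc _ _ a, hea, hab]⟩
  have hI : span (a * b) ≤ I := span_le (mul_mem a hbI)
  have hJ : span a ≤ J := span_le (ha ▸ (φ e).2)
  have hretr : inclusion hI ≫ rightMul (a * b) (fun x _ => mul_mem_span x _) = 𝟙 _ := by
    refine hom_ext ?_
    rintro ⟨_, y, rfl⟩
    change y * (a * b) * (a * b) = y * (a * b)
    rw [mul_assoc, ← mul_assoc (a * b), hab]
  exact ⟨{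
    coim := span (a * b)
    im := span a
    q := rightMul (a * b) fun x _ => mul_mem_span x _
    u := rightMul a fun x _ => mul_mem_span x a
    j := inclusion hJ
    retraction := ⟨inclusion hI, incl_inclusion hI, hretr⟩
    iso := isIso_rightMul_span hab
    inclusion := incl_inclusion hJ
    fac := hom_ext fun x => by
      rw [hφ]
      exact (mul_assoc _ _ _).trans (congrArg _ hab) }⟩

instance : IsNormalCategory (PrincipalLeftIdeal M) where
  splits {I J} j hj := by
    obtain ⟨e, he⟩ := I.exists_right_identity
    exact ⟨rightMul e fun x _ => mul_mem x e.2,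
      hom_ext fun x => (congrArg (· * (e : M)) (hj x)).trans (he x x.2)⟩
  exists_normalFactorisation := exists_normalFactorisation
  exists_cone I := by
    obtain ⟨e, he⟩ := I.exists_right_identity
    have hI : rightMul (e : M) (fun x _ => mul_mem x e.2) = 𝟙 I :=
      hom_ext fun x => he x x.2
    exact ⟨{
      app J := rightMul e fun x _ => mul_mem x e.2
      naturality j hj := hom_ext fun x => congrArg (· * (e : M)) (hj x)
      exists_iso := ⟨I, hI ▸ inferInstance⟩ }, hI⟩

/-- The cone `ρ^a` of right multiplications by `a`. -/
def rightMulCone (a : M) : NormalCone (span a) where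
  app I := rightMul a fun x _ => mul_mem_span x a
  naturality j hj := hom_ext fun x => congrArg (· * a) (hj x)
  exists_iso := by
    obtain ⟨b, hab, -⟩ := IsRegularSemigroup.exists_inverse a
    exact ⟨span (a * b), isIso_rightMul_span hab⟩

/-- The right regular representation of `M` by cones in its category of principal left ideals. -/
noncomputable def rightRegularRep : M →ₙ* Cones (PrincipalLeftIdeal M) where
  toFun a := ⟨span a, rightMulCone a⟩
  map_mul' a b := by
    have hp (x) (hx : x ∈ span a) : x * b ∈ span (a * b) := by
      obtain ⟨y, rfl⟩ := hx
      exact ⟨y, (mul_assoc y a b).symm⟩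
    have : Epi (rightMul b hp) := ConcreteCategory.epi_of_surjective _ <| by
      rintro ⟨_, y, rfl⟩
      exact ⟨⟨y * a, mul_mem_span y a⟩, Subtype.ext (mul_assoc y a b)⟩
    have hb : span (a * b) ≤ span b := span_le (mul_mem_span a b)
    refine ((Cones.mul_eq_star ⟨_, rightMulCone a⟩ ⟨_, rightMulCone b⟩ (rightMul b hp)
      (inclusion hb) (incl_inclusion hb) rfl).trans (congrArg (Cones.mk _) ?_)).symm
    exact NormalCone.ext <| funext fun I => hom_ext fun x => mul_assoc x.1 a b

end Semigroup

section Monoid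

variable {M : Type u} [Monoid M]

theorem mem_span_one (x : M) : x ∈ span (1 : M) := ⟨x, mul_one x⟩

theorem isBoundedAbove : IsBoundedAbove (PrincipalLeftIdeal M) :=
  ⟨span 1, fun I => ⟨_, incl_inclusion fun x (_ : x ∈ I) => mem_span_one x⟩⟩

theorem exists_cone_app_eq_mul {I : PrincipalLeftIdeal M} (γ : NormalCone I) :
    ∃ a ∈ I, ∀ (J : PrincipalLeftIdeal M) (x : J), (γ.app J x : M) = x * a := by
  let e : span (1 : M) := ⟨1, mem_span_one 1⟩
  refine ⟨γ.app _ e, (γ.app _ e).2, fun J x => ?_⟩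
  have hJ : J ≤ span 1 := fun y _ => mem_span_one y
  rw [← γ.naturality (inclusion hJ) (incl_inclusion hJ)]
  exact coe_apply_eq_mul (γ.app (span 1)) (mul_one x.1)

variable [IsRegularSemigroup M]

theorem bijective_rightRegularRep :
    Function.Bijective (rightRegularRep : M →ₙ* Cones (PrincipalLeftIdeal M)) := by
  constructor
  · intro a b hab
    let value (γ : Cones (PrincipalLeftIdeal M)) : M := γ.cone.app (span 1) ⟨1, mem_span_one 1⟩
    exact (one_mul a).symm.trans ((congrArg value hab).trans (one_mul b))
  · rintro ⟨I, γ⟩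
    obtain ⟨a, haI, ha⟩ := exists_cone_app_eq_mul γ
    have hI : I ≤ span a := fun y hy => by
      obtain ⟨J, hJ⟩ := γ.exists_iso
      obtain ⟨x, hx⟩ := (ConcreteCategory.bijective_of_isIso (γ.app J)).2 ⟨y, hy⟩
      exact ⟨x, (ha J x).symm.trans (congrArg Subtype.val hx)⟩
    obtain rfl : span a = I := (span_le haI).antisymm hI
    exact ⟨a, congrArg (Cones.mk _) <| NormalCone.ext <| funext fun J => hom_ext fun x =>
      (ha J x).symm⟩

end Monoid

end PrincipalLeftIdeal

/-! ### The equivalence -/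

/-- A small normal category `C`, regarded as the connected category `C_𝔇` with `𝔇 = Ĉ/ℛ`. -/
noncomputable def ConnectedCategory.ofNormal (C : Type u) [SmallCategory C] [SubobjectCategory C]
    [IsNormalCategory C] : ConnectedCategory.{u} where
  carrier := C
  downSet := ⊤
  connected c := by
    obtain ⟨μ, hμ⟩ := IsNormalCategory.exists_cone c
    exact ⟨_, trivial, μ, (isIdempotentElem_cone_iff μ).2 hμ, rfl⟩

theorem exists_coneSemigroup_mulEquiv (M : Type u) [Semigroup M] (hM : IsRegularMonoid M) :
    ∃ X : ConnectedCategory.{u}, isBoundedAboveNormal X ∧ Nonempty (X.coneSemigroup ≃* M) := by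
  obtain ⟨_, e, he⟩ := hM
  let _ : Monoid M :=
    { one := e
      one_mul a := (he a).1
      mul_one a := (he a).2 }
  let X := ConnectedCategory.ofNormal (PrincipalLeftIdeal M)
  exact ⟨X, ⟨rfl, PrincipalLeftIdeal.isBoundedAbove⟩, ⟨(X.coneSemigroupEquiv rfl).trans
    (MulEquiv.ofBijective _ PrincipalLeftIdeal.bijective_rightRegularRep).symm⟩⟩

instance : conesFunctor.{u}.EssSurj where
  mem_essImage S := by
    obtain ⟨X, hX, ⟨φ⟩⟩ := exists_coneSemigroup_mulEquiv S.obj S.property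
    exact ⟨⟨X, hX⟩, ⟨ObjectProperty.isoMk _ φ.toSemigrpIso⟩⟩

instance : conesFunctor.{u}.IsEquivalence where

end ConnCat

theorem theorem7 :
    (∀ (C : Type u) [Category.{v} C] [ConnCat.SubobjectCategory C] [ConnCat.IsNormalCategory C],
      ConnCat.IsBoundedAbove C → ConnCat.IsRegularMonoid (ConnCat.Cones C)) ∧
    Nonempty (CategoryTheory.Equivalence ConnCat.RegularMonoid.{u}
      ConnCat.BoundedAboveNormalCategory.{u}) :=
  ⟨fun _ => ConnCat.isRegularMonoid_cones, ⟨ConnCat.conesFunctor.asEquivalence.symm⟩⟩
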